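/- **Notation.** For an integer $M\ge 1$ let $V_{\sqrt M\,\mathbb Z}=\bigoplus_{m\in\mathbb Z}F_{m\sqrt M}$ be the lattice vertex superalgebra over $\mathbb C$. Here $F_\mu$ is the Fock module, with highest weight vector $|\mu\rangle$ satisfying $a_0|\mu\rangle=\mu|\mu\rangle$ and $a_n|\mu\rangle=0$ for $n>0$, of the Heisenberg algebra $[a_n,a_m]=n\,\delta_{n+m,0}$. For $\mu\in\sqrt M\,\mathbb Z$ let $$V_\mu(z)=Y(|\mu\rangle,z)=e^{\mu q}z^{\mu a_0}\exp\Big(-\mu\sum_{n<0}\frac{a_n}{n}z^{-n}\Big)\exp\Big(-\mu\sum_{n>0}\frac{a_n}{n}z^{-n}\Big),$$ where $e^{\mu q}\colon F_\lambda\to F_{\lambda+\mu}$ commutes with all $a_n$, $n\neq0$, and maps $|\lambda\rangle$ to $|\lambda+\mu\rangle$. Define modes $e_n$ and $\theta_n$ ($n\in\mathbb Z$) by $$V_{\sqrt{2N}}(z)=\sum_{n\in\mathbb Z}e_n z^{-n-N}\ \text{ on } V_{\sqrt{2N}\,\mathbb Z},\qquad V_{\sqrt{2N+1}}(z)=\sum_{n\in\mathbb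 Z}\theta_n z^{-n}\ \text{ on } V_{\sqrt{2N+1}\,\mathbb Z}.$$ For integers $0\le\theta\le l$, an infinite Fibonacci configuration of type $(\theta,l)$ is a function $a\colon\mathbb Z\to\{0,1\}$ such that $a_i+a_{i+1}+\dots+a_{i+l}\le 1$ for all $i$, $a_i=0$ for all sufficiently large $i$, and, for all sufficiently large $n$, $a_{-n}=1$ if $-n\equiv\theta \pmod{l+1}$ and $a_{-n}=0$ otherwise. Let $\mathrm{Fib}^{(\theta,l)}_\infty$ be the set of these, and let $\tau(a)_1<\tau(a)_2<\cdots$ be the increasing enumeration of $\{-j : a_j=1\}$. Semi-infinite monomials are vectors of $V_{\sqrt{2N}\,\mathbb Z}$, respectively $V_{\sqrt{2N+1}\,\mathbb Z}$, through the identifications, for all $j\in\mathbb Z$, $$e_{(-2j+1)N}\,e_{(-2j+3)N}\,e_{(-2j+5)N}\cdots=|j\sqrt{2N}\rangle,\qquad \theta_{(1-j)(2N+1)}\,\theta_{(2-j)(2N+1)}\,\theta_{(3-j)(2N+1)}\cdots=|j\sqrt{2N+1}\rangle .$$ That is, if the tail of a monomial from its $(K+1)$-st factor on is one of these, then the monomial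 is the product of its first $K$ factors applied to the corresponding $|j\sqrt{2N}\rangle$ or $|j\sqrt{2N+1}\rangle$; for all large $K$ this gives the same vector. **Theorem.** 1. For every integer $N\ge1$, the vectors $\mathbf e_a=e_{\tau(a)_1}e_{\tau(a)_2}e_{\tau(a)_3}\cdots$, $a\in\mathrm{Fib}^{(N,2N-1)}_\infty$, form a basis of $V_{\sqrt{2N}\,\mathbb Z}$. 2. For every integer $N\ge0$, the vectors $\boldsymbol\theta_a=\theta_{\tau(a)_1}\theta_{\tau(a)_2}\theta_{\tau(a)_3}\cdots$, $a\in\mathrm{Fib}^{(0,2N)}_\infty$, form a basis of $V_{\sqrt{2N+1}\,\mathbb Z}$. -/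

import Mathlib

open Filter

noncomputable section

namespace LatticeVOA

/-! ### The state space -/

/-- The Fock space of polynomials in the creation operators: the variable `X n` stands for
`a_{-(n+1)}`, `n = 0, 1, 2, …`. -/
abbrev Fock : Type := MvPolynomial ℕ ℂ

/-- The state space `V_{√N ℤ} = ⨁_{m ∈ ℤ} F_{m√N}` of the lattice vertex superalgebra; the
component at `m : ℤ` is the Fock module with highest weight `m√N`. -/
abbrev Space (_N : ℕ) : Type := ℤ →₀ Fock

/-- The highest weight vector `|m√N⟩`; `ket N 0` is the vacuum. -/
def ket (N : ℕ) (m : ℤ) : Space N := Finsupp.single m 1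

/-- The action of the Heisenberg modes `a_n`, `n ∈ ℤ`, on `V_{√N ℤ}`, with
`[a_n, a_m] = n δ_{n+m,0}`: the operator `a_{-(n+1)}` is multiplication by `X n`, the operator
`a_{n+1}` is `(n+1) ∂/∂X_n`, and `a_0` is the scalar `m√N` on the `m`-th summand. -/
def heis (N : ℕ) : ℤ → Module.End ℂ (Space N)
  | Int.ofNat 0 => Finsupp.lsum ℂ fun m : ℤ =>
      ((m : ℂ) * (Real.sqrt N : ℂ)) • (Finsupp.lsingle m : Fock →ₗ[ℂ] Space N)
  | Int.ofNat (n + 1) => Finsupp.mapRange.linearMap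
      (((n : ℂ) + 1) • (MvPolynomial.pderiv n : Derivation ℂ Fock Fock).toLinearMap)
  | Int.negSucc n => Finsupp.mapRange.linearMap
      (LinearMap.mulLeft ℂ (MvPolynomial.X n : Fock))

/-- The operator `e^{k√N q}`, which maps `F_{m√N}` identically onto `F_{(m+k)√N}`. -/
def shift (N : ℕ) (k : ℤ) : Module.End ℂ (Space N) :=
  Finsupp.lmapDomain Fock ℂ (fun m : ℤ => m + k)

/-! ### Vertex operators -/

/-- The exponential `∑_j f^j / j!` of a power series `f` with zero constant term over a (possibly
noncommutative) `ℂ`-algebra; as `f^j` starts in degree `j`, only `j ≤ r` contribute in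
degree `r`. -/
def expSeries {A : Type*} [Ring A] [Algebra ℂ A] (f : PowerSeries A) : PowerSeries A :=
  PowerSeries.mk fun r =>
    ∑ j ∈ Finset.range (r + 1), ((j.factorial : ℂ)⁻¹) • PowerSeries.coeff r (f ^ j)

/-- The factor `exp(-μ ∑_{n<0} (a_n / n) z^{-n})`, `μ = k√N`, as a power series in `z`. -/
def creation (N : ℕ) (k : ℤ) : PowerSeries (Module.End ℂ (Space N)) :=
  expSeries (PowerSeries.mk fun n =>
    if n = 0 then 0 else (((k : ℂ) * (Real.sqrt N : ℂ)) / (n : ℂ)) • heis N (-(n : ℤ)))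

/-- The factor `exp(-μ ∑_{n>0} (a_n / n) z^{-n})`, `μ = k√N`, as a power series in `z⁻¹`. -/
def annihilation (N : ℕ) (k : ℤ) : PowerSeries (Module.End ℂ (Space N)) :=
  expSeries (PowerSeries.mk fun n =>
    if n = 0 then 0 else (-((k : ℂ) * (Real.sqrt N : ℂ)) / (n : ℂ)) • heis N (n : ℤ))

/-- The coefficient of a power series at an integer exponent. -/
def intCoeff {A : Type*} [Ring A] (f : PowerSeries A) (r : ℤ) : A :=
  if 0 ≤ r then PowerSeries.coeff r.toNat f else 0

/-- The coefficient of `z^p` in the restriction to `F_{m√N}` of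
`e^{μq} z^{μ a_0} exp(-μ ∑_{n<0} (a_n / n) z^{-n}) exp(-μ ∑_{n>0} (a_n / n) z^{-n})`, `μ = k√N`.
On `F_{m√N}` the factor `z^{μ a_0}` is `z^{Nkm}`, and for each vector only finitely many of the
coefficients `s` of the last factor act nontrivially. -/
def modeFun (N : ℕ) (k p m : ℤ) (P : Fock) : Space N :=
  ∑ᶠ s : ℕ, shift N k (intCoeff (creation N k) (p - N * k * m + s)
    (PowerSeries.coeff s (annihilation N k) (Finsupp.single m P)))

/-! ### Finiteness: the vertex operators are well-defined fields -/

/-- Vectors whose polynomial components have weighted degree at most `D`, with `X n` of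
weight `n + 1`. -/
def filt (N : ℕ) (D : ℤ) : Submodule ℂ (Space N) where
  carrier := {v | ∀ (m : ℤ) (s : ℕ →₀ ℕ),
    D < (Finsupp.weight (fun i : ℕ => i + 1) s : ℕ) → MvPolynomial.coeff s (v m) = 0}
  add_mem' := by
    intro v w hv hw m s h
    simp [hv m s h, hw m s h]
  zero_mem' := by intro m s _; simp
  smul_mem' := by
    intro c v hv m s h
    simp [hv m s h]

theorem filt_eq_zero {N : ℕ} {D : ℤ} (hD : D < 0) {v : Space N} (hv : v ∈ filt N D) : v = 0 := by
  ext m s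
  simpa using hv m s (by omega)

theorem exists_mem_filt (N : ℕ) (m : ℤ) (P : Fock) :
    ∃ D : ℤ, (Finsupp.single m P : Space N) ∈ filt N D := by
  refine ⟨(P.support.sup fun s => Finsupp.weight (fun i : ℕ => i + 1) s : ℕ), ?_⟩
  intro m' s hs
  by_cases h : m' = m
  · subst h
    rw [Finsupp.single_eq_same]
    by_contra hne
    have := Finset.le_sup (f := fun s => Finsupp.weight (fun i : ℕ => i + 1) s)
      (MvPolynomial.mem_support_iff.2 hne)
    omega
  · rw [Finsupp.single_eq_of_ne h]; simp

theorem heis_mem_filt {N : ℕ} {D : ℤ} (n : ℕ) {v : Space N} (hv : v ∈ filt N D) :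
    heis N ((n + 1 : ℕ) : ℤ) v ∈ filt N (D - (n + 1 : ℕ)) := by
  intro m s hs
  have h1 : heis N ((n + 1 : ℕ) : ℤ) v m = ((n : ℂ) + 1) • MvPolynomial.pderiv n (v m) := rfl
  rw [h1, MvPolynomial.coeff_smul, MvPolynomial.coeff_pderiv,
    hv m (s + Finsupp.single n 1) ?_]
  · simp
  · rw [map_add, Finsupp.weight_single]
    simp only [smul_eq_mul]
    push_cast at hs ⊢
    linarith

theorem coeff_pow_mem_filt {N : ℕ} (f : PowerSeries (Module.End ℂ (Space N)))
    (hf : ∀ (n : ℕ) (D : ℤ) (v : Space N), v ∈ filt N D →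
      PowerSeries.coeff n f v ∈ filt N (D - n)) (j s : ℕ) :
    ∀ (D : ℤ) (v : Space N), v ∈ filt N D → PowerSeries.coeff s (f ^ j) v ∈ filt N (D - s) := by
  induction j generalizing s with
  | zero =>
    intro D v hv
    rw [pow_zero, PowerSeries.coeff_one]
    split_ifs with h
    · subst h; simpa using hv
    · simp
  | succ j ih =>
    intro D v hv
    rw [pow_succ, PowerSeries.coeff_mul, LinearMap.sum_apply]
    refine Submodule.sum_mem _ fun x hx => ?_
    have hx' : x.1 + x.2 = s := Finset.HasAntidiagonal.mem_antidiagonal.1 hx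
    have := ih x.1 _ _ (hf x.2 D v hv)
    rw [Module.End.mul_apply]
    have e : D - (s : ℤ) = D - x.2 - x.1 := by omega
    rw [e]; exact this

theorem annihilation_mem_filt (N : ℕ) (k : ℤ) (s : ℕ) {D : ℤ} {v : Space N}
    (hv : v ∈ filt N D) : PowerSeries.coeff s (annihilation N k) v ∈ filt N (D - s) := by
  rw [annihilation, expSeries, PowerSeries.coeff_mk, LinearMap.sum_apply]
  refine Submodule.sum_mem _ fun j _ => ?_
  rw [LinearMap.smul_apply]
  refine Submodule.smul_mem _ _ (coeff_pow_mem_filt _ ?_ j s D v hv)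
  intro n D v hv
  rw [PowerSeries.coeff_mk]
  cases n with
  | zero => simp
  | succ n =>
    rw [if_neg (Nat.succ_ne_zero n), LinearMap.smul_apply]
    exact Submodule.smul_mem _ _ (heis_mem_filt n hv)

theorem annihilation_eventually_zero (N : ℕ) (k m : ℤ) (P : Fock) :
    ∃ S : ℕ, ∀ s : ℕ, S < s →
      PowerSeries.coeff s (annihilation N k) (Finsupp.single m P : Space N) = 0 := by
  obtain ⟨D, hD⟩ := exists_mem_filt N m P
  refine ⟨D.toNat, fun s hs => filt_eq_zero ?_ (annihilation_mem_filt N k s hD)⟩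
  omega

theorem modeFun_finite (N : ℕ) (k p m : ℤ) (P : Fock) :
    (Function.support fun s : ℕ => shift N k (intCoeff (creation N k) (p - N * k * m + s)
      (PowerSeries.coeff s (annihilation N k) (Finsupp.single m P)))).Finite := by
  obtain ⟨S, hS⟩ := annihilation_eventually_zero N k m P
  refine (Set.finite_Iic S).subset fun s hs => ?_
  by_contra h
  exact hs (by simp [hS s (not_le.1 h)])

/-- The coefficient of `z^p` in the vertex operator `V_{k√N}(z)`, as an operator on
`V_{√N ℤ}`. -/
def mode (N : ℕ) (k p : ℤ) : Module.End ℂ (Space N) :=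
  Finsupp.lsum ℂ fun m : ℤ =>
    { toFun := modeFun N k p m
      map_add' := by
        intro P Q
        unfold modeFun
        rw [← finsum_add_distrib (modeFun_finite N k p m P) (modeFun_finite N k p m Q)]
        simp only [Finsupp.single_add, map_add]
      map_smul' := by
        intro c P
        unfold modeFun
        rw [RingHom.id_apply, smul_finsum]
        simp only [← Finsupp.smul_single, map_smul] }

theorem mode_bddBelow (N : ℕ) (k : ℤ) (v : Space N) :
    BddBelow (Function.support fun p : ℤ => mode N k p v) := by
  induction v using Finsupp.induction_linear with
  | zero => simp
  | add v w hv hw =>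
    refine (hv.union hw).mono fun p hp => ?_
    by_contra h
    simp only [Set.mem_union, Function.mem_support, not_or, not_not] at h
    exact hp (by simp [h.1, h.2])
  | single m P =>
    obtain ⟨S, hS⟩ := annihilation_eventually_zero N k m P
    refine ⟨N * k * m - S, fun p hp => ?_⟩
    by_contra h
    refine hp ?_
    have e : mode N k p (Finsupp.single m P) = modeFun N k p m P := by
      simp [mode, Finsupp.lsum_single]
    simp only [e, modeFun]
    refine finsum_eq_zero_of_forall_eq_zero fun s => ?_
    by_cases hs : S < s
    · simp [hS s hs]
    · rw [intCoeff, if_neg (by omega)]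
      simp

/-- The vertex operator `V_{k√N}(z) = Y(|k√N⟩, z)` of `V_{√N ℤ}`. -/
def vertexOp (N : ℕ) (k : ℤ) : VertexOperator ℂ (Space N) :=
  VertexOperator.of_coeff (mode N k) (mode_bddBelow N k)

/-- The modes of `e(z) = V_{√(2N)}(z) = ∑ e_n z^{-n-N}` in `V_{√(2N) ℤ}`. -/
def e (N : ℕ) (n : ℤ) : Module.End ℂ (Space (2 * N)) :=
  HVertexOperator.coeff (vertexOp (2 * N) 1) (-n - N)

/-- The modes of `θ(z) = V_{√(2N+1)}(z) = ∑ θ_n z^{-n}` in `V_{√(2N+1) ℤ}`. -/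
def theta (N : ℕ) (n : ℤ) : Module.End ℂ (Space (2 * N + 1)) :=
  HVertexOperator.coeff (vertexOp (2 * N + 1) 1) (-n)

/-! ### Semi-infinite monomials -/

/-- `v` is the value of the semi-infinite monomial `x_{i 0} x_{i 1} x_{i 2} ⋯`, where the
semi-infinite monomial `x_{t j 0} x_{t j 1} x_{t j 2} ⋯` is identified with the vector `|j√N⟩`
for every `j : ℤ`: for all large `K` the tail `x_{i K} x_{i (K+1)} ⋯` is one of these, and `v` is
`x_{i 0} ⋯ x_{i (K-1)} |j√N⟩`. -/
def IsSemiInfiniteMonomial {N : ℕ} (x : ℤ → Module.End ℂ (Space N)) (t : ℤ → ℕ → ℤ)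
    (i : ℕ → ℤ) (v : Space N) : Prop :=
  ∀ᶠ K : ℕ in atTop, ∃ j : ℤ, (∀ n : ℕ, i (K + n) = t j n) ∧
    v = ((List.range K).map fun n => x (i n)).prod (ket N j)

/-- The indices of the monomial `e_{(-2j+1)N} e_{(-2j+3)N} e_{(-2j+5)N} ⋯` identified with
`|j√(2N)⟩`. -/
def evenTail (N : ℕ) (j : ℤ) (n : ℕ) : ℤ := (-2 * j + 1 + 2 * n) * N

/-- The indices of the monomial `θ_{(1-j)(2N+1)} θ_{(2-j)(2N+1)} θ_{(3-j)(2N+1)} ⋯` identified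
with `|j√(2N+1)⟩`. -/
def oddTail (N : ℕ) (j : ℤ) (n : ℕ) : ℤ := (1 - j + n) * (2 * N + 1)

/-! ### Infinite Fibonacci configurations -/

/-- Infinite Fibonacci configurations of type `(θ, l)`. -/
def Fib (θ l : ℕ) : Set (ℤ → ℕ) :=
  {a | (∀ i, a i = 0 ∨ a i = 1) ∧
    (∀ i : ℤ, ∑ r ∈ Finset.range (l + 1), a (i + r) ≤ 1) ∧
    (∀ᶠ i : ℤ in atTop, a i = 0) ∧
    (∀ᶠ i : ℤ in atBot, (i ≡ θ [ZMOD (l + 1)] → a i = 1) ∧ (¬ i ≡ θ [ZMOD (l + 1)] → a i = 0))}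

/-- The sequence `τ(a)`, numbered from `0`: the positions `j` with `a j ≠ 0`, listed from the
largest one downwards and negated. -/
def tau (a : ℤ → ℕ) : ℕ → ℤ
  | 0 => -sSup {j : ℤ | a j ≠ 0}
  | n + 1 => -sSup {j : ℤ | a j ≠ 0 ∧ j < -tau a n}

end LatticeVOA

end

noncomputable section

namespace LatticeVOA

/-! ### Triangular perturbations of a basis -/

/-! Write `M` for `2N` or `2N+1`. A configuration amounts to a charge `m` and a partition `λ`:
counted from the top, starting at `n = 0`, its occupied positions are `M(m-1-n) + θ + λ_n`. The
exclusion condition makes `λ` weakly decreasing, and the periodic tail makes it eventually zero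
(`exists_isCode_of_mem_fib`, `exists_fib_isCode`).

The `n`-th factor of the monomial acts on the summand of charge `m-1-n`. With `l = λ_n` it sends `P`
to `h_l P + ∑_{s≥1} h_{l+s} D_s P`, where `h_r` is a coefficient of the creation exponential and
`D_s`, a coefficient of the annihilation exponential, lowers the weight by `s` (`mode_single`). The
smallest parts act first, so `l` is at least as large as every part already present. Each correction
therefore contains a part exceeding all parts of the leading product, while its weight is no larger.
Hence the monomial is `h_λ` plus a combination of `h_μ` with `|μ| ≤ |λ|` and `μ` later in the order
that compares multiplicities of the largest parts first (`listVec_triangular`).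

By Newton's identities the `h_r`, `r ≥ 1`, freely generate the Fock space (`completeEquiv`), so the
`h_λ` form a basis in each charge. Only finitely many `μ` have bounded weight, so the triangularity
is well founded (`wellFounded_higher`), and a unitriangular perturbation of a basis is a basis
(`exists_basis_of_triangular`). Commutation relations between the modes play no role, and both
parities are the same argument with different `M` and `θ`. -/

theorem bijective_of_locally_nilpotent {R V : Type*} [Ring R] [AddCommGroup V] [Module R V]
    (T : Module.End R V) (h : ∀ v, ∃ n : ℕ, ((T - 1) ^ n) v = 0) : Function.Bijective T := by
  constructor
  · rw [← LinearMap.ker_eq_bot, LinearMap.ker_eq_bot']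
    intro v hv
    obtain ⟨n, hn⟩ := h v
    induction n with
    | zero => simpa using hn
    | succ n ih =>
      apply ih
      rw [pow_succ, Module.End.mul_apply, LinearMap.sub_apply, hv] at hn
      simpa using hn
  · intro v
    obtain ⟨n, hn⟩ := h v
    -- The inverse of `T = 1 + (T - 1)` is the geometric series in `-(T - 1)`, which is finite on
    -- each vector.
    have h1 : T * ∑ i ∈ Finset.range n, (-(T - 1)) ^ i = 1 - (-(T - 1)) ^ n := by
      have := mul_neg_geom_sum (-(T - 1)) n
      rwa [show 1 - -(T - 1) = T by abel] at this
    refine ⟨(∑ i ∈ Finset.range n, (-(T - 1)) ^ i) v, ?_⟩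
    rw [← Module.End.mul_apply, h1, LinearMap.sub_apply]
    rw [neg_pow, Module.End.mul_apply, hn, map_zero, sub_zero, Module.End.one_apply]

/-- The endomorphism `T` with `b i ↦ v i` differs from the identity by a map sending `b i` into the
span of earlier `b j`. Well-founded induction makes this difference locally nilpotent, so `T` is
bijective. -/
theorem exists_basis_of_triangular {ι R V : Type*} [Ring R] [AddCommGroup V] [Module R V]
    (b : Module.Basis ι R V) (v : ι → V) (r : ι → ι → Prop) (wf : WellFounded r)
    (h : ∀ i, v i - b i ∈ Submodule.span R (b '' {j | r j i})) :
    ∃ b' : Module.Basis ι R V, ∀ i, b' i = v i := by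
  classical
  -- The scalars of `constr` are `ℕ` because `R` need not be commutative.
  set T : Module.End R V := b.constr ℕ v with hT
  have hTb : ∀ i, T (b i) = v i := fun i => b.constr_basis ℕ v i
  let L : Submodule R V :=
    { carrier := {x | ∃ n : ℕ, ((T - 1) ^ n) x = 0}
      add_mem' := by
        rintro x y ⟨n, hn⟩ ⟨m, hm⟩
        refine ⟨n + m, ?_⟩
        rw [map_add]
        nth_rewrite 1 [add_comm n m]
        rw [pow_add, pow_add, Module.End.mul_apply, Module.End.mul_apply, hn, hm]
        simp
      zero_mem' := ⟨0, by simp⟩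
      smul_mem' := by
        rintro c x ⟨n, hn⟩
        exact ⟨n, by rw [map_smul, hn, smul_zero]⟩ }
  have hL : ∀ i, b i ∈ L := by
    intro i
    induction i using wf.induction with
    | _ i ih =>
      have h1 : v i - b i ∈ L := by
        refine (Submodule.span_le.2 ?_) (h i)
        rintro _ ⟨j, hj, rfl⟩
        exact ih j hj
      obtain ⟨n, hn⟩ := h1
      refine ⟨n + 1, ?_⟩
      rw [pow_succ, Module.End.mul_apply, LinearMap.sub_apply, hTb]
      exact hn
  have hb := bijective_of_locally_nilpotent T fun x => by
    have : x ∈ L := by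
      have : (⊤ : Submodule R V) ≤ L := by
        rw [← b.span_eq, Submodule.span_le]
        rintro _ ⟨i, rfl⟩
        exact hL i
      exact this trivial
    exact this
  exact ⟨b.map (LinearEquiv.ofBijective T hb), fun i => by simp [hTb]⟩

/-! ### The order on monomials -/

/-- The weight of a monomial, `X n` having weight `n + 1`. -/
def wt (s : ℕ →₀ ℕ) : ℕ := Finsupp.weight (fun i : ℕ => i + 1) s

theorem wt_add (s t : ℕ →₀ ℕ) : wt (s + t) = wt s + wt t := map_add _ _ _

theorem wt_zero : wt 0 = 0 := map_zero _

theorem wt_single (i k : ℕ) : wt (Finsupp.single i k) = k * (i + 1) := by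
  simp [wt, Finsupp.weight_single]

/-- Weight at most `d` bounds every multiplicity by `d` and every index in the support by `d - 1`.
-/
theorem finite_wt_le (d : ℕ) : {t | wt t ≤ d}.Finite := by
  refine (Set.finite_Iic (Finsupp.onFinset (Finset.range d) (fun i => if i < d then d else 0)
    (by intro a; simp +contextual))).subset fun t ht => ?_
  intro i
  rw [Finsupp.onFinset_apply]
  have ht' : wt t ≤ d := ht
  by_cases h0 : t i = 0
  · simp [h0]
  · have h1 : t i ≤ wt t := Finsupp.le_weight _ (by simp) t
    have h2 : i + 1 ≤ wt t := Finsupp.le_weight_of_ne_zero' (fun i : ℕ => i + 1) h0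
    rw [if_pos (by omega)]
    omega

/-- The strict lexicographic order on exponents in which the largest index is compared
first. -/
def ColexLT (s t : ℕ →₀ ℕ) : Prop := ∃ i, s i < t i ∧ ∀ j, i < j → s j = t j

theorem ColexLT.trans {s t u : ℕ →₀ ℕ} (h : ColexLT s t) (h' : ColexLT t u) : ColexLT s u := by
  obtain ⟨i, hi, hi'⟩ := h
  obtain ⟨j, hj, hj'⟩ := h'
  rcases lt_trichotomy i j with hij | hij | hij
  · exact ⟨j, (hi' j hij).trans_lt hj, fun k hk => (hi' k (hij.trans hk)).trans (hj' k hk)⟩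
  · subst hij
    exact ⟨i, hi.trans hj, fun k hk => (hi' k hk).trans (hj' k hk)⟩
  · exact ⟨i, hi.trans_eq (hj' i hij), fun k hk => (hi' k hk).trans (hj' k (hij.trans hk))⟩

theorem ColexLT.irrefl (s : ℕ →₀ ℕ) : ¬ ColexLT s s := fun ⟨_, h, _⟩ => h.false

theorem ColexLT.add_right {s t : ℕ →₀ ℕ} (h : ColexLT s t) (u : ℕ →₀ ℕ) :
    ColexLT (s + u) (t + u) := by
  obtain ⟨i, hi, hi'⟩ := h
  exact ⟨i, by simpa using hi, fun j hj => by simp [hi' j hj]⟩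

theorem colexLT_of_forall_eq_zero {s t : ℕ →₀ ℕ} (l : ℕ) (hs : ∀ i, l ≤ i → s i = 0) {i : ℕ}
    (hi : l ≤ i) (ht : t i ≠ 0) : ColexLT s t := by
  classical
  have hne : (t.support.filter (l ≤ ·)).Nonempty := ⟨i, by simp [hi, ht]⟩
  have hm := Finset.max'_mem _ hne
  set k := (t.support.filter (l ≤ ·)).max' hne
  rw [Finset.mem_filter, Finsupp.mem_support_iff] at hm
  refine ⟨k, by rw [hs k hm.2]; exact Nat.pos_of_ne_zero hm.1, fun j hj => ?_⟩
  rw [hs j (hm.2.trans hj.le)]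
  by_contra h
  have := Finset.le_max' (t.support.filter (l ≤ ·)) j
    (by simp only [Finset.mem_filter, Finsupp.mem_support_iff]; exact ⟨Ne.symm h, by omega⟩)
  omega

/-- `Higher t s`: the monomial `t` has at most the weight of `s` and comes after it. -/
def Higher (t s : ℕ →₀ ℕ) : Prop := wt t ≤ wt s ∧ ColexLT s t

theorem Higher.trans {s t u : ℕ →₀ ℕ} (h : Higher u t) (h' : Higher t s) : Higher u s :=
  ⟨h.1.trans h'.1, h'.2.trans h.2⟩

/-- The finite set of monomials above `s` shrinks strictly when `s` is replaced by one of its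
members `t`, since `t` itself drops out. -/
theorem wellFounded_higher : WellFounded Higher := by
  refine Subrelation.wf (r := InvImage (· < ·) fun s => {t | Higher t s}.ncard) ?_
    (InvImage.wf _ Nat.lt_wfRel.wf)
  intro t s h
  refine Set.ncard_lt_ncard ?_ ((finite_wt_le (wt s)).subset fun u hu => hu.1)
  refine ⟨fun u hu => Higher.trans hu h, fun hsub => ?_⟩
  exact ColexLT.irrefl t (hsub (show t ∈ {t | Higher t s} from h)).2

/-! ### The weight filtration of the Fock space -/

/-- Polynomials of weighted degree at most `D`. -/
def fockFilt (D : ℤ) : Submodule ℂ Fock where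
  carrier := {P | ∀ s : ℕ →₀ ℕ, D < (wt s : ℕ) → MvPolynomial.coeff s P = 0}
  add_mem' := by
    intro v w hv hw s h
    simp [hv s h, hw s h]
  zero_mem' := by intro s _; simp
  smul_mem' := by
    intro c v hv s h
    simp [hv s h]

theorem fockFilt_mono {D E : ℤ} (h : D ≤ E) : fockFilt D ≤ fockFilt E :=
  fun _ hP s hs => hP s (h.trans_lt hs)

theorem fockFilt_eq_zero {D : ℤ} (hD : D < 0) {P : Fock} (hP : P ∈ fockFilt D) : P = 0 := by
  ext s
  simpa using hP s (by omega)

theorem monomial_mem_fockFilt (s : ℕ →₀ ℕ) (c : ℂ) {D : ℤ} (h : (wt s : ℤ) ≤ D) :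
    MvPolynomial.monomial s c ∈ fockFilt D := by
  intro t ht
  rw [MvPolynomial.coeff_monomial, if_neg]
  rintro rfl
  omega

theorem one_mem_fockFilt : (1 : Fock) ∈ fockFilt 0 :=
  monomial_mem_fockFilt 0 1 (by simp [wt_zero])

theorem X_mem_fockFilt (n : ℕ) : (MvPolynomial.X n : Fock) ∈ fockFilt (n + 1) :=
  monomial_mem_fockFilt _ 1 (by simp [wt_single])

theorem mul_mem_fockFilt {D E : ℤ} {P Q : Fock} (hP : P ∈ fockFilt D) (hQ : Q ∈ fockFilt E) :
    P * Q ∈ fockFilt (D + E) := by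
  intro s hs
  rw [MvPolynomial.coeff_mul]
  refine Finset.sum_eq_zero fun x hx => ?_
  rw [Finset.HasAntidiagonal.mem_antidiagonal] at hx
  by_cases h : D < (wt x.1 : ℕ)
  · rw [hP _ h, zero_mul]
  · rw [hQ x.2, mul_zero]
    rw [← hx, wt_add] at hs
    push_cast at hs
    omega

theorem mem_span_of_mem_fockFilt {D : ℤ} {P : Fock} (hP : P ∈ fockFilt D) :
    P ∈ Submodule.span ℂ
      ((fun s => (MvPolynomial.monomial s 1 : Fock)) '' {s | (wt s : ℤ) ≤ D}) := by
  rw [P.as_sum]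
  refine Submodule.sum_mem _ fun s hs => ?_
  have : (MvPolynomial.monomial s (P.coeff s) : Fock)
      = P.coeff s • MvPolynomial.monomial s 1 := by
    rw [MvPolynomial.smul_monomial, smul_eq_mul, mul_one]
  rw [this]
  refine Submodule.smul_mem _ _ (Submodule.subset_span ⟨s, ?_, rfl⟩)
  by_contra h
  exact MvPolynomial.mem_support_iff.1 hs (hP s (not_le.1 h))

theorem aeval_mem_fockFilt {g : ℕ → Fock} (hg : ∀ i : ℕ, g i ∈ fockFilt (i + 1)) {D : ℤ}
    {P : Fock} (hP : P ∈ fockFilt D) : MvPolynomial.aeval g P ∈ fockFilt D := by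
  have key : ∀ s : ℕ →₀ ℕ, MvPolynomial.aeval g (MvPolynomial.monomial s (1 : ℂ))
      ∈ fockFilt (wt s) := by
    intro s
    induction s using Finsupp.induction_linear with
    | zero =>
      rw [wt_zero]
      simpa using one_mem_fockFilt
    | add s t hs ht =>
      rw [wt_add, ← one_mul (1 : ℂ), ← MvPolynomial.monomial_mul, map_mul]
      push_cast
      exact mul_mem_fockFilt hs ht
    | single i k =>
      induction k with
      | zero =>
        rw [Finsupp.single_zero, wt_zero]
        simpa using one_mem_fockFilt
      | succ k ih =>
        rw [Finsupp.single_add, wt_add, ← one_mul (1 : ℂ), ← MvPolynomial.monomial_mul, map_mul]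
        push_cast
        refine mul_mem_fockFilt ih ?_
        have : (MvPolynomial.monomial (Finsupp.single i 1) (1 : ℂ) : Fock) = MvPolynomial.X i := rfl
        rw [this, MvPolynomial.aeval_X, wt_single]
        simpa using hg i
  have h := Submodule.mem_map_of_mem (f := (MvPolynomial.aeval g).toLinearMap)
    (mem_span_of_mem_fockFilt hP)
  rw [Submodule.map_span] at h
  refine (Submodule.span_le.2 ?_) h
  rintro _ ⟨_, ⟨s, hs, rfl⟩, rfl⟩
  exact fockFilt_mono hs (key s)

/-! ### Exponentials of power series -/

/-- Lets the vertex operator factors, defined on the whole state space, be computed on one Fock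
space; for the creation factor even in the commutative ring `Fock`. -/
theorem expSeries_map {A B : Type*} [Ring A] [Algebra ℂ A] [Ring B] [Algebra ℂ B] (φ : A →ₐ[ℂ] B)
    (f : PowerSeries A) (r : ℕ) :
    PowerSeries.coeff r (expSeries (f.map (φ : A →+* B))) =
      φ (PowerSeries.coeff r (expSeries f)) := by
  rw [expSeries, expSeries, PowerSeries.coeff_mk, PowerSeries.coeff_mk, map_sum]
  refine Finset.sum_congr rfl fun j _ => ?_
  rw [← map_pow, PowerSeries.coeff_map, map_smul]
  rfl

theorem coeff_zero_expSeries {A : Type*} [Ring A] [Algebra ℂ A] (f : PowerSeries A) :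
    PowerSeries.coeff 0 (expSeries f) = 1 := by
  simp [expSeries]

/-- Since `f^j` has order at least `j`, one truncation serves all coefficients up to degree `n`. -/
theorem coeff_expSeries_of_le {A : Type*} [CommRing A] [Algebra ℂ A] (f : PowerSeries A)
    (hf : PowerSeries.constantCoeff f = 0) {r n : ℕ} (h : r ≤ n) :
    PowerSeries.coeff r (expSeries f) =
      ∑ j ∈ Finset.range (n + 1), ((j.factorial : ℂ)⁻¹) • PowerSeries.coeff r (f ^ j) := by
  rw [expSeries, PowerSeries.coeff_mk]
  refine Finset.sum_subset (Finset.range_subset_range.2 (by omega)) fun j _ hj => ?_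
  rw [Finset.mem_range, not_lt] at hj
  rw [PowerSeries.coeff_of_lt_order, smul_zero]
  refine lt_of_lt_of_le ?_ (PowerSeries.le_order_pow_of_constantCoeff_eq_zero j hf)
  exact_mod_cast hj

/-- The coefficient of degree `n` in `(exp f)' = f' · exp f`. -/
theorem coeff_succ_expSeries {A : Type*} [CommRing A] [Algebra ℂ A] (f : PowerSeries A)
    (hf : PowerSeries.constantCoeff f = 0) (n : ℕ) :
    ((n : A) + 1) * PowerSeries.coeff (n + 1) (expSeries f) =
      ∑ i ∈ Finset.range (n + 1), (((i : A) + 1) * PowerSeries.coeff (i + 1) f) *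
        PowerSeries.coeff (n - i) (expSeries f) := by
  have h1 : ((n : A) + 1) * PowerSeries.coeff (n + 1) (expSeries f) =
      ∑ j ∈ Finset.range (n + 1), ((j.factorial : ℂ)⁻¹) •
        PowerSeries.coeff n (f ^ j * PowerSeries.derivative A f) := by
    rw [coeff_expSeries_of_le f hf le_rfl, Finset.sum_range_succ']
    rw [pow_zero, PowerSeries.coeff_one, if_neg (by omega), smul_zero, mul_add, mul_zero, add_zero]
    rw [Finset.mul_sum]
    refine Finset.sum_congr rfl fun j _ => ?_
    have h2 := PowerSeries.coeff_derivative (f ^ (j + 1)) n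
    rw [PowerSeries.derivative_pow] at h2
    rw [mul_smul_comm, mul_comm, ← h2, Nat.add_sub_cancel, mul_assoc, ← nsmul_eq_mul, map_nsmul,
      ← Nat.cast_smul_eq_nsmul ℂ, smul_smul, Nat.factorial_succ]
    congr 1
    have : (j.factorial : ℂ) ≠ 0 := by exact_mod_cast j.factorial_ne_zero
    have : ((j : ℂ) + 1) ≠ 0 := by exact_mod_cast j.succ_ne_zero
    push_cast
    field_simp
  rw [h1]
  have h3 : ∀ j, PowerSeries.coeff n (f ^ j * PowerSeries.derivative A f) =
      ∑ i ∈ Finset.range (n + 1), (((i : A) + 1) * PowerSeries.coeff (i + 1) f) *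
        PowerSeries.coeff (n - i) (f ^ j) := by
    intro j
    rw [mul_comm, PowerSeries.coeff_mul, Finset.Nat.sum_antidiagonal_eq_sum_range_succ_mk]
    refine Finset.sum_congr rfl fun i _ => ?_
    rw [PowerSeries.coeff_derivative]
    ring
  simp_rw [h3, Finset.smul_sum]
  rw [Finset.sum_comm]
  refine Finset.sum_congr rfl fun i _ => ?_
  rw [coeff_expSeries_of_le f hf (Nat.sub_le n i), Finset.mul_sum]
  exact Finset.sum_congr rfl fun j _ => (mul_smul_comm _ _ _).symm

/-! ### Complete symmetric functions -/

/-- The power series `∑_{n>0} (c / n) X_{n-1} z^n`. -/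
def powerSumSeries (c : ℂ) : PowerSeries Fock :=
  PowerSeries.mk fun n => if n = 0 then 0 else (c / (n : ℂ)) • MvPolynomial.X (n - 1)

/-- The coefficients of `exp(∑_{n>0} (c / n) X_{n-1} z^n)`. -/
def complete (c : ℂ) (r : ℕ) : Fock := PowerSeries.coeff r (expSeries (powerSumSeries c))

theorem complete_zero (c : ℂ) : complete c 0 = 1 := coeff_zero_expSeries _

/-- Newton's identity, with `c X_i` as the power sum of degree `i + 1` and `complete c r` as the
complete symmetric function. -/
theorem succ_mul_complete (c : ℂ) (n : ℕ) :
    ((n : Fock) + 1) * complete c (n + 1) =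
      ∑ i ∈ Finset.range (n + 1), (c • MvPolynomial.X i) * complete c (n - i) := by
  rw [complete, coeff_succ_expSeries _ (by simp [powerSumSeries])]
  refine Finset.sum_congr rfl fun i _ => ?_
  congr 1
  rw [powerSumSeries, PowerSeries.coeff_mk, if_neg (Nat.succ_ne_zero i), Nat.add_sub_cancel]
  have h : ((i : Fock) + 1) = algebraMap ℂ Fock ((i : ℂ) + 1) := by simp
  rw [h, ← Algebra.smul_def, smul_smul]
  congr 1
  have : ((i : ℂ) + 1) ≠ 0 := by exact_mod_cast i.succ_ne_zero
  push_cast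
  field_simp

theorem succ_smul_complete (c : ℂ) (n : ℕ) :
    ((n : ℂ) + 1) • complete c (n + 1) =
      ∑ i ∈ Finset.range (n + 1), (c • MvPolynomial.X i) * complete c (n - i) := by
  rw [← succ_mul_complete, Algebra.smul_def]
  simp

theorem complete_succ (c : ℂ) (n : ℕ) :
    complete c (n + 1) = ((n : ℂ) + 1)⁻¹ •
      ∑ i ∈ Finset.range (n + 1), (c • MvPolynomial.X i) * complete c (n - i) := by
  have : ((n : ℂ) + 1) ≠ 0 := by exact_mod_cast n.succ_ne_zero
  rw [← succ_smul_complete, smul_smul, inv_mul_cancel₀ this, one_smul]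

theorem complete_mem_fockFilt (c : ℂ) (r : ℕ) : complete c r ∈ fockFilt r := by
  induction r using Nat.strong_induction_on with
  | _ r ih =>
    cases r with
    | zero =>
      rw [complete_zero]
      simpa using one_mem_fockFilt
    | succ n =>
      rw [complete_succ]
      refine Submodule.smul_mem _ _ (Submodule.sum_mem _ fun i hi => ?_)
      rw [Finset.mem_range] at hi
      refine fockFilt_mono ?_ (mul_mem_fockFilt (Submodule.smul_mem _ c (X_mem_fockFilt i))
        (ih (n - i) (by omega)))
      omega

/-- The polynomial expressing `X n` through the `complete c (i + 1)`, `i ≤ n`. -/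
def newton (c : ℂ) (n : ℕ) : Fock :=
  c⁻¹ • (((n : ℂ) + 1) • MvPolynomial.X n) -
    ∑ i : Fin n, newton c i * MvPolynomial.X (n - i - 1)
termination_by n

theorem newton_eq (c : ℂ) (n : ℕ) :
    newton c n = c⁻¹ • (((n : ℂ) + 1) • MvPolynomial.X n) -
      ∑ i ∈ Finset.range n, newton c i * MvPolynomial.X (n - i - 1) := by
  rw [newton, Finset.sum_range]

theorem newton_mem_fockFilt (c : ℂ) (n : ℕ) : newton c n ∈ fockFilt (n + 1) := by
  induction n using Nat.strong_induction_on with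
  | _ n ih =>
    rw [newton_eq]
    refine Submodule.sub_mem _ (Submodule.smul_mem _ _ (Submodule.smul_mem _ _ (X_mem_fockFilt n)))
      (Submodule.sum_mem _ fun i hi => ?_)
    rw [Finset.mem_range] at hi
    refine fockFilt_mono ?_ (mul_mem_fockFilt (ih i hi) (X_mem_fockFilt _))
    omega

theorem aeval_complete_newton {c : ℂ} (hc : c ≠ 0) (n : ℕ) :
    MvPolynomial.aeval (fun i => complete c (i + 1)) (newton c n) = MvPolynomial.X n := by
  induction n using Nat.strong_induction_on with
  | _ n ih =>
    rw [newton_eq, map_sub, map_smul, map_smul, MvPolynomial.aeval_X, succ_smul_complete,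
      Finset.sum_range_succ, Nat.sub_self, complete_zero, mul_one, smul_add, smul_smul,
      inv_mul_cancel₀ hc, one_smul, add_sub_right_comm, map_sum, Finset.smul_sum,
      ← Finset.sum_sub_distrib, Finset.sum_eq_zero, zero_add]
    intro i hi
    rw [Finset.mem_range] at hi
    rw [map_mul, ih i hi, MvPolynomial.aeval_X, Nat.sub_add_cancel (by omega), smul_mul_assoc,
      smul_smul, inv_mul_cancel₀ hc, one_smul, sub_self]

theorem aeval_newton_complete {c : ℂ} (hc : c ≠ 0) (n : ℕ) :
    MvPolynomial.aeval (newton c) (complete c (n + 1)) = MvPolynomial.X n := by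
  induction n using Nat.strong_induction_on with
  | _ n ih =>
    have hn : ((n : ℂ) + 1) ≠ 0 := by exact_mod_cast n.succ_ne_zero
    have h : ∀ i ∈ Finset.range n, MvPolynomial.aeval (newton c)
        ((c • MvPolynomial.X i) * complete c (n - i)) =
          c • (newton c i * MvPolynomial.X (n - i - 1)) := by
      intro i hi
      rw [Finset.mem_range] at hi
      rw [map_mul, map_smul, MvPolynomial.aeval_X, smul_mul_assoc]
      rw [show n - i = n - i - 1 + 1 by omega, ih (n - i - 1) (by omega)]
      rfl
    rw [complete_succ, map_smul, map_sum, Finset.sum_range_succ, Finset.sum_congr rfl h,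
      Nat.sub_self, complete_zero, mul_one, map_smul, MvPolynomial.aeval_X, newton_eq c n,
      ← Finset.smul_sum, smul_sub, add_sub_cancel, smul_smul, smul_smul,
      mul_assoc, mul_inv_cancel₀ hc, mul_one, smul_smul, inv_mul_cancel₀ hn, one_smul]

/-- The automorphism of the Fock space with `X i ↦ complete c (i + 1)`. -/
def completeEquiv {c : ℂ} (hc : c ≠ 0) : Fock ≃ₐ[ℂ] Fock :=
  AlgEquiv.ofAlgHom (MvPolynomial.aeval fun i => complete c (i + 1))
    (MvPolynomial.aeval (newton c))
    (by
      ext1 n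
      rw [AlgHom.comp_apply, MvPolynomial.aeval_X, aeval_complete_newton hc, AlgHom.id_apply])
    (by
      ext1 n
      rw [AlgHom.comp_apply, MvPolynomial.aeval_X, aeval_newton_complete hc, AlgHom.id_apply])

theorem completeEquiv_X {c : ℂ} (hc : c ≠ 0) (n : ℕ) :
    completeEquiv hc (MvPolynomial.X n) = complete c (n + 1) :=
  MvPolynomial.aeval_X _ _

/-- The product of the `complete c (i + 1)` with multiplicities `s i`. -/
def completeProd {c : ℂ} (hc : c ≠ 0) (s : ℕ →₀ ℕ) : Fock :=
  completeEquiv hc (MvPolynomial.monomial s 1)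

theorem completeProd_add {c : ℂ} (hc : c ≠ 0) (s t : ℕ →₀ ℕ) :
    completeProd hc (s + t) = completeProd hc s * completeProd hc t := by
  rw [completeProd, ← one_mul (1 : ℂ), ← MvPolynomial.monomial_mul, map_mul]
  rfl

theorem completeProd_zero {c : ℂ} (hc : c ≠ 0) : completeProd hc 0 = 1 :=
  map_one (completeEquiv hc)

/-- The exponent of a single part of size `l`; a part of size `0` does not count. -/
def part (l : ℕ) : ℕ →₀ ℕ := if l = 0 then 0 else Finsupp.single (l - 1) 1

theorem wt_part (l : ℕ) : wt (part l) = l := by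
  unfold part
  split_ifs with h
  · rw [h, wt_zero]
  · rw [wt_single]
    omega

theorem part_apply_of_le {l i : ℕ} (h : l ≤ i) : part l i = 0 := by
  unfold part
  split_ifs with h0
  · rfl
  · rw [Finsupp.single_eq_of_ne (by omega)]

theorem completeProd_part {c : ℂ} (hc : c ≠ 0) (l : ℕ) :
    completeProd hc (part l) = complete c l := by
  unfold part
  split_ifs with h
  · rw [h, completeProd_zero, complete_zero]
  · have := completeEquiv_X hc (l - 1)
    rwa [Nat.sub_add_cancel (by omega)] at this

/-- The `completeProd` form a basis of the Fock space. -/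
def completeBasis {c : ℂ} (hc : c ≠ 0) : Module.Basis (ℕ →₀ ℕ) ℂ Fock :=
  (MvPolynomial.basisMonomials ℕ ℂ).map (completeEquiv hc).toLinearEquiv

theorem completeBasis_apply {c : ℂ} (hc : c ≠ 0) (s : ℕ →₀ ℕ) :
    completeBasis hc s = completeProd hc s := by
  simp [completeBasis, completeProd]

theorem completeProd_mem_fockFilt {c : ℂ} (hc : c ≠ 0) (s : ℕ →₀ ℕ) :
    completeProd hc s ∈ fockFilt (wt s) :=
  aeval_mem_fockFilt (fun i => by exact_mod_cast complete_mem_fockFilt c (i + 1))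
    (monomial_mem_fockFilt s 1 le_rfl)

/-- Both the change of generators and its inverse respect the weight filtration, so the expansion in
the new basis involves no larger weights. -/
theorem mem_span_completeProd {c : ℂ} (hc : c ≠ 0) {D : ℤ} {P : Fock} (hP : P ∈ fockFilt D) :
    P ∈ Submodule.span ℂ (completeProd hc '' {s | (wt s : ℤ) ≤ D}) := by
  have h : (completeEquiv hc).symm P ∈ fockFilt D :=
    aeval_mem_fockFilt (fun i => newton_mem_fockFilt c i) hP
  have h1 := Submodule.mem_map_of_mem (f := (completeEquiv hc).toLinearMap)
    (mem_span_of_mem_fockFilt h)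
  rw [Submodule.map_span, Set.image_image] at h1
  have h2 : (completeEquiv hc).toLinearMap ((completeEquiv hc).symm P) = P :=
    (completeEquiv hc).apply_symm_apply P
  rwa [h2] at h1

/-! ### The vertex operator on the summands -/

/-- Operators on the Fock space act on every summand of the state space. -/
def componentwise (N : ℕ) : Module.End ℂ Fock →ₐ[ℂ] Module.End ℂ (Space N) where
  toFun f := Finsupp.mapRange.linearMap f
  map_one' := Finsupp.mapRange.linearMap_id
  map_mul' f g := Finsupp.mapRange.linearMap_comp f g
  map_zero' := by ext; simp
  map_add' f g := by ext; simp
  commutes' r := by ext; simp [Module.algebraMap_end_apply]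

theorem componentwise_single (N : ℕ) (f : Module.End ℂ Fock) (m : ℤ) (P : Fock) :
    componentwise N f (Finsupp.single m P) = Finsupp.single m (f P) :=
  Finsupp.mapRange_single (hf := map_zero f)

/-- The coefficients of `exp(-∑_{n>0} c z^{-n} ∂/∂X_{n-1})`. -/
def lowering (c : ℂ) (s : ℕ) : Module.End ℂ Fock :=
  PowerSeries.coeff s (expSeries (PowerSeries.mk fun n =>
    if n = 0 then 0 else (-c / (n : ℂ)) • ((((n - 1 : ℕ) : ℂ) + 1) •
      (MvPolynomial.pderiv (n - 1) : Derivation ℂ Fock Fock).toLinearMap)))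

theorem coeff_annihilation_single (N : ℕ) (s : ℕ) (m : ℤ) (P : Fock) :
    PowerSeries.coeff s (annihilation N 1) (Finsupp.single m P) =
      Finsupp.single m (lowering (Real.sqrt N : ℂ) s P) := by
  rw [← componentwise_single, lowering]
  refine Eq.trans ?_ (LinearMap.congr_fun (expSeries_map (A := Module.End ℂ Fock)
    (B := Module.End ℂ (Space N)) (componentwise N) _ s) _)
  rw [annihilation]
  congr 3
  ext n : 1
  rw [PowerSeries.coeff_map, PowerSeries.coeff_mk, PowerSeries.coeff_mk]
  cases n with
  | zero => simp
  | succ n =>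
    rw [if_neg n.succ_ne_zero, if_neg n.succ_ne_zero, Int.cast_one, one_mul]
    exact (map_smul (componentwise N) _ _).symm

theorem coeff_creation_single (N : ℕ) (r : ℕ) (m : ℤ) (P : Fock) :
    PowerSeries.coeff r (creation N 1) (Finsupp.single m P) =
      Finsupp.single m (complete (Real.sqrt N : ℂ) r * P) := by
  refine Eq.trans ?_ (componentwise_single N
    (LinearMap.mulLeft ℂ (complete (Real.sqrt N : ℂ) r)) m P)
  refine Eq.trans ?_ (LinearMap.congr_fun
    (expSeries_map (B := Module.End ℂ (Space N)) ((componentwise N).comp (Algebra.lmul ℂ Fock)) _ r) _)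
  rw [creation]
  congr 3
  ext n : 1
  rw [PowerSeries.coeff_map, PowerSeries.coeff_mk, powerSumSeries, PowerSeries.coeff_mk]
  cases n with
  | zero => simp
  | succ n =>
    rw [if_neg n.succ_ne_zero, if_neg n.succ_ne_zero, Int.cast_one, one_mul]
    exact (map_smul ((componentwise N).comp (Algebra.lmul ℂ Fock)) _ _).symm

theorem lowering_zero (c : ℂ) : lowering c 0 = 1 := coeff_zero_expSeries _

theorem single_mem_filt_iff {N : ℕ} {D : ℤ} {m : ℤ} {P : Fock} :
    (Finsupp.single m P : Space N) ∈ filt N D ↔ P ∈ fockFilt D := by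
  constructor
  · intro h s hs
    simpa using h m s hs
  · intro h m' s hs
    by_cases h' : m' = m
    · subst h'
      rw [Finsupp.single_eq_same]
      exact h s hs
    · rw [Finsupp.single_eq_of_ne h']; simp

/-- Inherited from the estimate for `annihilation`, hence only for `c = √N`. -/
theorem lowering_mem_fockFilt (N : ℕ) (s : ℕ) {D : ℤ} {P : Fock} (hP : P ∈ fockFilt D) :
    lowering (Real.sqrt N : ℂ) s P ∈ fockFilt (D - s) := by
  have := annihilation_mem_filt N 1 s (single_mem_filt_iff (N := N) (m := 0).2 hP)
  rwa [coeff_annihilation_single, single_mem_filt_iff] at this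

/-- On charge `m` the factor `z^{μ a_0}` contributes `N m` to the exponent, so annihilation in
degree `s` is paired with creation in degree `l + s`. Terms with `s > D` vanish on `P`; the leading
term `s = 0` is split off. -/
theorem mode_single (N : ℕ) (l : ℕ) (m : ℤ) {D : ℕ} {P : Fock} (hP : P ∈ fockFilt D) :
    mode N 1 (N * m + l) (Finsupp.single m P) = Finsupp.single (m + 1)
      (complete (Real.sqrt N : ℂ) l * P + ∑ s ∈ Finset.range D,
        complete (Real.sqrt N : ℂ) (l + (s + 1)) * lowering (Real.sqrt N : ℂ) (s + 1) P) := by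
  have h1 : mode N 1 (N * m + l) (Finsupp.single m P) = modeFun N 1 (N * m + l) m P := by
    simp [mode, Finsupp.lsum_single]
  have h2 : ∀ s : ℕ, shift N 1 (intCoeff (creation N 1) (N * m + l - N * 1 * m + s)
      (PowerSeries.coeff s (annihilation N 1) (Finsupp.single m P))) =
      Finsupp.single (m + 1) (complete (Real.sqrt N : ℂ) (l + s) *
        lowering (Real.sqrt N : ℂ) s P) := by
    intro s
    rw [coeff_annihilation_single, show (N * m + l - N * 1 * m + s : ℤ) = ((l + s : ℕ) : ℤ) by
      push_cast; ring, intCoeff, if_pos (by omega), Int.toNat_natCast, coeff_creation_single]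
    exact Finsupp.mapDomain_single
  rw [h1, modeFun, finsum_congr h2, finsum_eq_sum_of_support_subset (s := Finset.range (D + 1))]
  · rw [Finset.sum_range_succ', lowering_zero, ← Finsupp.single_finsetSum, add_comm,
      ← Finsupp.single_add]
    rfl
  · intro s hs
    rw [Finset.coe_range, Set.mem_Iio]
    by_contra h
    refine hs ?_
    beta_reduce
    rw [fockFilt_eq_zero (D := D - s) (by omega) (lowering_mem_fockFilt N s hP)]
    simp

theorem mode_ket (N : ℕ) (m : ℤ) : mode N 1 (N * m) (ket N m) = ket N (m + 1) := by
  have := mode_single N 0 m (D := 0) one_mem_fockFilt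
  simpa [complete_zero, ket] using this

/-! ### Triangularity of the monomials -/

/-- The exponent of the product of the parts in a list. -/
def listExp (L : List ℕ) : ℕ →₀ ℕ := (L.map part).sum

theorem listExp_cons (l : ℕ) (L : List ℕ) : listExp (l :: L) = part l + listExp L := by
  simp [listExp]

theorem listExp_apply_of_le {L : List ℕ} {l i : ℕ} (hL : ∀ x ∈ L, x ≤ l) (h : l ≤ i) :
    listExp L i = 0 := by
  induction L with
  | nil => simp [listExp]
  | cons x L ih =>
    rw [List.forall_mem_cons] at hL
    rw [listExp_cons, Finsupp.add_apply, ih hL.2, part_apply_of_le (hL.1.trans h)]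

/-- The vector obtained from `|j√N⟩` by applying the vertex operator modes that raise the weight
by the entries of a list, from the last entry to the first. -/
def listVec (N : ℕ) (j : ℤ) : List ℕ → Space N
  | [] => ket N j
  | l :: L => mode N 1 (N * (j + L.length) + l) (listVec N j L)

theorem complete_mul_mem_span {c : ℂ} (hc : c ≠ 0) (l : ℕ) {A B : Set (ℕ →₀ ℕ)}
    (hAB : ∀ t ∈ A, part l + t ∈ B) {P : Fock}
    (hP : P ∈ Submodule.span ℂ (completeProd hc '' A)) :
    complete c l * P ∈ Submodule.span ℂ (completeProd hc '' B) := by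
  have h := Submodule.mem_map_of_mem (f := LinearMap.mulLeft ℂ (complete c l)) hP
  rw [Submodule.map_span, Set.image_image] at h
  refine Submodule.span_mono ?_ h
  rintro _ ⟨t, ht, rfl⟩
  refine ⟨part l + t, hAB t ht, ?_⟩
  rw [completeProd_add, completeProd_part]
  rfl

/-- Induction on the list. The weight bound in `Higher` is what keeps the vector in the filtration
step needed for the next mode. -/
theorem listVec_triangular {N : ℕ} (hc : (Real.sqrt N : ℂ) ≠ 0) (j : ℤ) (L : List ℕ)
    (hL : L.Pairwise (· ≥ ·)) :
    ∃ P : Fock, listVec N j L = Finsupp.single (j + L.length) P ∧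
      P - completeProd hc (listExp L) ∈
        Submodule.span ℂ (completeProd hc '' {t | Higher t (listExp L)}) := by
  induction L with
  | nil =>
    refine ⟨1, by simp [listVec, ket], ?_⟩
    rw [listExp, List.map_nil, List.sum_nil, completeProd_zero, sub_self]
    exact Submodule.zero_mem _
  | cons l L ih =>
    rw [List.pairwise_cons] at hL
    obtain ⟨P, hP, hspan⟩ := ih hL.2
    have hfilt : P ∈ fockFilt (wt (listExp L)) := by
      have h1 : P - completeProd hc (listExp L) ∈ fockFilt (wt (listExp L)) := by
        refine Submodule.span_le.2 ?_ hspan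
        rintro _ ⟨t, ht, rfl⟩
        exact fockFilt_mono (by exact_mod_cast ht.1) (completeProd_mem_fockFilt hc t)
      simpa using Submodule.add_mem _ h1 (completeProd_mem_fockFilt hc (listExp L))
    have hvec := mode_single N l (j + L.length) hfilt
    rw [← hP, add_assoc j, ← Nat.cast_succ, Nat.succ_eq_add_one,
      ← List.length_cons (a := l)] at hvec
    refine ⟨_, hvec, ?_⟩
    rw [listExp_cons, completeProd_add, completeProd_part, add_sub_right_comm, ← mul_sub]
    refine Submodule.add_mem _ (complete_mul_mem_span hc l (fun t ht => ?_) hspan)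
      (Submodule.sum_mem _ fun s hs => ?_)
    -- Corrections already present in `P`: multiplying by `h_l` preserves both the order and the
    -- weight comparison.
    · refine ⟨by rw [wt_add, wt_add]; exact Nat.add_le_add_left ht.1 _, ?_⟩
      rw [add_comm (part l), add_comm (part l)]
      exact ht.2.add_right _
    -- New corrections: the part `l + s + 1` exceeds all parts of `l :: L`, because `l` is the
    -- largest of them, and its excess `s + 1` over `l` is offset by the weight lost under lowering.
    · refine complete_mul_mem_span hc _ (fun t ht => ?_)
        (mem_span_completeProd hc (lowering_mem_fockFilt N (s + 1) hfilt))
      refine ⟨?_, colexLT_of_forall_eq_zero l (i := l + s) (fun i hi => ?_) (by omega) ?_⟩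
      · have ht' : (wt t : ℤ) ≤ (wt (listExp L) : ℤ) - ((s + 1 : ℕ) : ℤ) := ht
        rw [wt_add, wt_add, wt_part, wt_part]
        omega
      · rw [← listExp_cons]
        exact listExp_apply_of_le (by simpa using hL.1) hi
      · rw [Finsupp.add_apply, part, if_neg (by omega), show l + (s + 1) - 1 = l + s by omega,
          Finsupp.single_eq_same]
        omega

theorem prod_range'_ket {N : ℕ} {θ : ℤ} {x : ℤ → Module.End ℂ (Space N)}
    (hx : ∀ n, x n = mode N 1 (-n - θ)) {τ : ℕ → ℤ} {lam : ℕ → ℕ} {m : ℤ}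
    (h : ∀ n : ℕ, τ n = -(N * (m - 1 - n) + θ + lam n)) (k n : ℕ) :
    ((List.range' n k).map fun i => x (τ i)).prod (ket N (m - n - k)) =
      listVec N (m - n - k) ((List.range' n k).map lam) := by
  induction k generalizing n with
  | zero => simp [listVec]
  | succ k ih =>
    have ih' := ih (n + 1)
    rw [show m - ((n + 1 : ℕ) : ℤ) - k = m - n - ((k + 1 : ℕ) : ℤ) by push_cast; ring] at ih'
    rw [List.range'_succ, List.map_cons, List.map_cons, List.prod_cons, Module.End.mul_apply, ih',
      listVec, hx, h]
    congr 2
    rw [List.length_map, List.length_range']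
    push_cast
    ring

theorem prod_range_ket {N : ℕ} {θ : ℤ} {x : ℤ → Module.End ℂ (Space N)}
    (hx : ∀ n, x n = mode N 1 (-n - θ)) {τ : ℕ → ℤ} {lam : ℕ → ℕ} {m : ℤ}
    (h : ∀ n : ℕ, τ n = -(N * (m - 1 - n) + θ + lam n)) (k : ℕ) :
    ((List.range k).map fun i => x (τ i)).prod (ket N (m - k)) =
      listVec N (m - k) ((List.range k).map lam) := by
  simpa [List.range_eq_range'] using prod_range'_ket hx h k 0

/-- A factor with `lam n = 0` merely carries one highest weight vector to the next, so the value
does not depend on where the tail is cut. -/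
theorem prod_range_ket_of_le {N : ℕ} {θ : ℤ} {x : ℤ → Module.End ℂ (Space N)}
    (hx : ∀ n, x n = mode N 1 (-n - θ)) {τ : ℕ → ℤ} {lam : ℕ → ℕ} {m : ℤ}
    (h : ∀ n : ℕ, τ n = -(N * (m - 1 - n) + θ + lam n)) {K : ℕ} (hK : ∀ n, K ≤ n → lam n = 0)
    {k : ℕ} (hk : K ≤ k) :
    ((List.range k).map fun i => x (τ i)).prod (ket N (m - k)) =
      ((List.range K).map fun i => x (τ i)).prod (ket N (m - K)) := by
  induction k, hk using Nat.le_induction with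
  | base => rfl
  | succ k hk ih =>
    rw [← ih, List.range_succ, List.map_append, List.prod_append, Module.End.mul_apply]
    congr 1
    have := mode_ket N (m - ((k + 1 : ℕ) : ℤ))
    rw [show m - ((k + 1 : ℕ) : ℤ) + 1 = m - k by push_cast; ring] at this
    rw [← this, List.map_singleton, List.prod_singleton, hx, h, hK k hk]
    congr 2
    push_cast
    ring

/-! ### Exponents and decreasing lists -/

/-- The exponent determines the largest part, and one peels it off. Equal length is required because
parts of size `0` leave no trace in the exponent. -/
theorem eq_of_listExp_eq {L L' : List ℕ} (hL : L.Pairwise (· ≥ ·)) (hL' : L'.Pairwise (· ≥ ·))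
    (hlen : L.length = L'.length) (h : listExp L = listExp L') : L = L' := by
  have aux : ∀ (l l' : ℕ) (L L' : List ℕ), (l :: L).Pairwise (· ≥ ·) →
      listExp (l :: L) = listExp (l' :: L') → l' ≤ l := by
    intro l l' L L' hL h
    by_contra! hlt
    have h1 : listExp (l :: L) (l' - 1) = 0 :=
      listExp_apply_of_le (l := l) (by simpa using (List.pairwise_cons.1 hL).1) (by omega)
    rw [h, listExp_cons, Finsupp.add_apply, part, if_neg (by omega), Finsupp.single_eq_same] at h1
    omega
  induction L generalizing L' with
  | nil => exact (List.length_eq_zero_iff.1 hlen.symm).symm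
  | cons l L ih =>
    cases L' with
    | nil => simp at hlen
    | cons l' L' =>
      have e : l = l' := le_antisymm (aux _ _ _ _ hL' h.symm) (aux _ _ _ _ hL h)
      subst e
      rw [listExp_cons, listExp_cons, add_right_inj] at h
      rw [ih (List.pairwise_cons.1 hL).2 (List.pairwise_cons.1 hL').2 (by simpa using hlen) h]

theorem exists_listExp_eq (s : ℕ →₀ ℕ) : ∃ L : List ℕ, L.Pairwise (· ≥ ·) ∧ listExp L = s := by
  have h : ∃ L : List ℕ, listExp L = s := by
    induction s using Finsupp.induction_linear with
    | zero => exact ⟨[], rfl⟩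
    | add s t hs ht =>
      obtain ⟨L, rfl⟩ := hs
      obtain ⟨L', rfl⟩ := ht
      exact ⟨L ++ L', by simp [listExp]⟩
    | single i k => exact ⟨List.replicate k (i + 1), by simp [listExp, part]⟩
  obtain ⟨L, rfl⟩ := h
  refine ⟨L.insertionSort (· ≥ ·), List.pairwise_insertionSort _ _, ?_⟩
  exact ((List.perm_insertionSort _ L).map part).sum_eq

theorem listExp_map_range {lam : ℕ → ℕ} {K : ℕ} (hK : ∀ n, K ≤ n → lam n = 0) {k : ℕ}
    (hk : K ≤ k) : listExp ((List.range k).map lam) = listExp ((List.range K).map lam) := by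
  induction k, hk using Nat.le_induction with
  | base => rfl
  | succ k hk ih =>
    rw [← ih, List.range_succ]
    simp [listExp, hK k hk, part]

theorem pairwise_map_range {lam : ℕ → ℕ} (h : Antitone lam) (k : ℕ) :
    ((List.range k).map lam).Pairwise (· ≥ ·) :=
  List.pairwise_map.2 (List.pairwise_lt_range.imp fun hab => h hab.le)

/-! ### The enumeration of a configuration -/

/-- The two hypotheses ensure that every supremum in `tau` is over a nonempty set bounded above, so
it is attained instead of taking its default value. -/
theorem apply_neg_tau_ne_zero {a : ℤ → ℕ} (ha : BddAbove {j | a j ≠ 0})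
    (hb : ∀ B : ℤ, ∃ j < B, a j ≠ 0) (n : ℕ) : a (-tau a n) ≠ 0 := by
  cases n with
  | zero =>
    obtain ⟨j, -, hj⟩ := hb 0
    rw [tau, neg_neg]
    exact Int.csSup_mem (s := {j | a j ≠ 0}) ⟨j, hj⟩ ha
  | succ n =>
    obtain ⟨j, hj, hj'⟩ := hb (-tau a n)
    rw [tau, neg_neg]
    exact (Int.csSup_mem (s := {j | a j ≠ 0 ∧ j < -tau a n}) ⟨j, hj', hj⟩
      (ha.mono fun _ h => h.1)).1

theorem neg_tau_succ_lt {a : ℤ → ℕ} (ha : BddAbove {j | a j ≠ 0})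
    (hb : ∀ B : ℤ, ∃ j < B, a j ≠ 0) (n : ℕ) :
    -tau a (n + 1) < -tau a n := by
  obtain ⟨j, hj, hj'⟩ := hb (-tau a n)
  rw [tau, neg_neg]
  exact (Int.csSup_mem (s := {j | a j ≠ 0 ∧ j < -tau a n}) ⟨j, hj', hj⟩
    (ha.mono fun _ h => h.1)).2

theorem le_neg_tau_succ {a : ℤ → ℕ} (ha : BddAbove {j | a j ≠ 0}) {n : ℕ} {j : ℤ} (hj : a j ≠ 0)
    (h : j < -tau a n) : j ≤ -tau a (n + 1) := by
  rw [tau, neg_neg]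
  exact le_csSup (ha.mono fun _ h => h.1) ⟨hj, h⟩

/-- If `j` were skipped, the integers `-tau a n` would decrease strictly forever while staying above
`j`. -/
theorem exists_neg_tau_eq {a : ℤ → ℕ} (ha : BddAbove {j | a j ≠ 0})
    (hb : ∀ B : ℤ, ∃ j < B, a j ≠ 0) {j : ℤ} (hj : a j ≠ 0) : ∃ n, -tau a n = j := by
  by_contra! h
  have h1 : ∀ n : ℕ, j < -tau a n ∧ -tau a n + n ≤ -tau a 0 := by
    intro n
    induction n with
    | zero =>
      refine ⟨lt_of_le_of_ne ?_ (h 0).symm, by simp⟩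
      rw [tau, neg_neg]
      exact le_csSup ha hj
    | succ n ih =>
      refine ⟨lt_of_le_of_ne (le_neg_tau_succ ha hj ih.1) (h (n + 1)).symm, ?_⟩
      have := neg_tau_succ_lt ha hb n
      push_cast
      omega
  have := h1 (-tau a 0 - j).toNat
  omega

theorem tau_eq_of_enumeration {a : ℤ → ℕ} {f : ℕ → ℤ} (hf : StrictAnti f)
    (h : ∀ j, a j ≠ 0 ↔ ∃ n, f n = j) (n : ℕ) : tau a n = -f n := by
  induction n with
  | zero =>
    rw [tau, neg_inj]
    refine IsGreatest.csSup_eq ⟨(h _).2 ⟨0, rfl⟩, ?_⟩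
    rintro j hj
    obtain ⟨n, rfl⟩ := (h j).1 hj
    exact hf.antitone (Nat.zero_le n)
  | succ n ih =>
    rw [tau, neg_inj, ih, neg_neg]
    refine IsGreatest.csSup_eq ⟨⟨(h _).2 ⟨n + 1, rfl⟩, hf (Nat.lt_succ_self n)⟩, ?_⟩
    rintro j ⟨hj, hlt⟩
    obtain ⟨k, rfl⟩ := (h j).1 hj
    exact hf.antitone (hf.lt_iff_gt.1 hlt)

/-! ### Configurations as pairs of a charge and a partition -/

/-- The sequence `τ` belongs to the charge `m` and the partition `lam`, which vanishes from `K`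
on. -/
structure IsCode (M : ℕ) (θ : ℤ) (τ : ℕ → ℤ) (m : ℤ) (lam : ℕ → ℕ) (K : ℕ) : Prop where
  antitone : Antitone lam
  eq_zero : ∀ n, K ≤ n → lam n = 0
  eq : ∀ n : ℕ, τ n = -(M * (m - 1 - n) + θ + lam n)

theorem IsCode.unique {M : ℕ} (hM : 0 < M) {θ : ℤ} {τ : ℕ → ℤ} {m m' : ℤ} {lam lam' : ℕ → ℕ}
    {K K' : ℕ} (h : IsCode M θ τ m lam K) (h' : IsCode M θ τ m' lam' K') :
    m = m' ∧ lam = lam' := by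
  have hm : m = m' := by
    have h1 := h.eq (max K K')
    have h2 := h'.eq (max K K')
    rw [h.eq_zero _ (le_max_left _ _)] at h1
    rw [h'.eq_zero _ (le_max_right _ _), h1] at h2
    have h3 : (M : ℤ) * m = M * m' := by linarith
    exact mul_left_cancel₀ (by exact_mod_cast hM.ne') h3
  subst hm
  refine ⟨rfl, funext fun n => ?_⟩
  have h1 := h.eq n
  rw [h'.eq n] at h1
  omega

theorem bddAbove_of_mem_fib {θ l : ℕ} {a : ℤ → ℕ} (ha : a ∈ Fib θ l) : BddAbove {j | a j ≠ 0} := by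
  obtain ⟨B, hB⟩ := eventually_atTop.1 ha.2.2.1
  refine ⟨B, fun j hj => ?_⟩
  by_contra! h
  exact hj (hB j h.le)

theorem exists_lt_of_mem_fib {θ l : ℕ} {a : ℤ → ℕ} (ha : a ∈ Fib θ l) (B : ℤ) :
    ∃ j < B, a j ≠ 0 := by
  obtain ⟨C, hC⟩ := eventually_atBot.1 ha.2.2.2
  -- The multiplier of `l + 1` is negative, so replacing `l + 1` by `1` only increases the left
  -- side, leaving `min B C - 1 - |min B C|`.
  have h1 : (θ : ℤ) + (l + 1) * (min B C - 1 - θ - |min B C|) ≤ min B C - 1 := by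
    have h2 := le_abs_self (min B C)
    have h3 : (0 : ℤ) ≤ l := by positivity
    have h4 : (0 : ℤ) ≤ θ := by positivity
    have h5 := neg_abs_le (min B C)
    nlinarith [abs_nonneg (min B C)]
  refine ⟨(θ : ℤ) + (l + 1) * (min B C - 1 - θ - |min B C|), by
    have := min_le_left B C
    omega, ?_⟩
  rw [(hC _ (by have := min_le_right B C; omega)).1 ?_]
  · exact one_ne_zero
  · exact (Int.modEq_iff_dvd.2 ⟨-(min B C - 1 - θ - |min B C|), by ring⟩)

/-- Otherwise the window of length `l + 1` starting at `i` would contain two particles. -/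
theorem add_le_of_mem_fib {θ l : ℕ} {a : ℤ → ℕ} (ha : a ∈ Fib θ l)
    {i j : ℤ} (hi : a i ≠ 0) (hj : a j ≠ 0)
    (hij : i < j) : i + (l + 1) ≤ j := by
  by_contra! h
  have h1 := ha.2.1 i
  have h2 := Finset.add_le_sum (f := fun r : ℕ => a (i + r)) (s := Finset.range (l + 1))
    (fun _ _ => Nat.zero_le _) (i := 0) (j := (j - i).toNat) (by simp)
    (by rw [Finset.mem_range]; omega) (by omega)
  rw [Int.toNat_of_nonneg (by omega), add_sub_cancel] at h2
  simp only [Nat.cast_zero, add_zero] at h2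
  omega

theorem exists_isCode_of_mem_fib {θ l : ℕ} {a : ℤ → ℕ} (ha : a ∈ Fib θ l) :
    ∃ m lam K, IsCode (l + 1) θ (tau a) m lam K := by
  have hne := apply_neg_tau_ne_zero (bddAbove_of_mem_fib ha) (exists_lt_of_mem_fib ha)
  have hlt := neg_tau_succ_lt (bddAbove_of_mem_fib ha) (exists_lt_of_mem_fib ha)
  have hgap : ∀ n, -tau a (n + 1) + (l + 1) ≤ -tau a n := fun n =>
    add_le_of_mem_fib ha (hne _) (hne _) (hlt n)
  obtain ⟨C, hC⟩ := eventually_atBot.1 ha.2.2.2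
  obtain ⟨K, hK⟩ : ∃ K, -tau a K ≤ C := by
    obtain ⟨j, hj, hj'⟩ := (exists_lt_of_mem_fib ha) C
    obtain ⟨n, rfl⟩ := exists_neg_tau_eq (bddAbove_of_mem_fib ha) (exists_lt_of_mem_fib ha) hj'
    exact ⟨n, hj.le⟩
  have hmod : -tau a K ≡ θ [ZMOD (l + 1)] := by
    by_contra h
    exact hne K ((hC _ hK).2 h)
  obtain ⟨q, hq⟩ := Int.modEq_iff_dvd.1 hmod.symm
  -- In the periodic region the exclusion condition gives gaps of at least `l + 1`, and the next
  -- site of the residue class is occupied, so the gaps are exactly `l + 1`.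
  have htail : ∀ n : ℕ, -tau a (K + n) = θ + (l + 1) * (q - n) := by
    intro n
    induction n with
    | zero =>
      rw [add_zero]
      push_cast
      linarith
    | succ n ih =>
      have h1 := hgap (K + n)
      have h2 : θ + (l + 1) * (q - (n + 1 : ℕ)) ≤ -tau a (K + n + 1) := by
        refine le_neg_tau_succ (bddAbove_of_mem_fib ha) ?_ ?_
        · rw [(hC _ ?_).1 ?_]
          · exact one_ne_zero
          · push_cast
            nlinarith
          · exact (Int.modEq_iff_dvd.2 ⟨-(q - (n + 1 : ℕ)), by ring⟩)
        · rw [ih]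
          push_cast
          nlinarith
      refine le_antisymm ?_ h2
      rw [← add_assoc]
      push_cast
      linarith
  -- The displacement from the ground state that agrees with `a` in the tail. It is weakly
  -- decreasing by the gap bound and eventually zero, hence nonnegative.
  set d : ℕ → ℤ := fun n => -tau a n - θ - (l + 1) * (q + K - n) with hd
  have hd0 : ∀ n, K ≤ n → d n = 0 := by
    intro n hn
    obtain ⟨k, rfl⟩ := Nat.exists_eq_add_of_le hn
    simp only [hd, htail]
    push_cast
    ring
  have hanti : Antitone d := antitone_nat_of_succ_le fun n => by
    have := hgap n
    simp only [hd]
    push_cast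
    linarith
  have hpos : ∀ n, 0 ≤ d n := fun n => by
    rw [← hd0 (max n K) (le_max_right _ _)]
    exact hanti (le_max_left _ _)
  -- The charge solves `m - 1 - K = q`, matching the code to the tail at index `K`.
  refine ⟨q + K + 1, fun n => (d n).toNat, K, fun n k hnk => Int.toNat_le_toNat (hanti hnk),
    fun n hn => by simp [hd0 n hn], fun n => ?_⟩
  rw [Int.toNat_of_nonneg (hpos n)]
  simp only [hd]
  push_cast
  ring

theorem eq_of_tau_eq {θ l : ℕ} {a a' : ℤ → ℕ} (ha : a ∈ Fib θ l) (ha' : a' ∈ Fib θ l)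
    (h : tau a = tau a') : a = a' := by
  have key : ∀ {a a' : ℤ → ℕ}, a ∈ Fib θ l → a' ∈ Fib θ l → tau a = tau a' →
      ∀ j, a j ≠ 0 → a' j ≠ 0 := by
    intro a a' ha ha' h j hj
    obtain ⟨n, rfl⟩ := exists_neg_tau_eq (bddAbove_of_mem_fib ha) (exists_lt_of_mem_fib ha) hj
    rw [h]
    exact apply_neg_tau_ne_zero (bddAbove_of_mem_fib ha') (exists_lt_of_mem_fib ha') n
  funext j
  have h1 := key ha ha' h j
  have h2 := key ha' ha h.symm j
  have h3 := ha.1 j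
  have h4 := ha'.1 j
  omega

theorem exists_fib_isCode (θ l : ℕ) (m : ℤ) {lam : ℕ → ℕ} (hlam : Antitone lam) {K : ℕ}
    (hK : ∀ n, K ≤ n → lam n = 0) : ∃ a ∈ Fib θ l, IsCode (l + 1) θ (tau a) m lam K := by
  classical
  set f : ℕ → ℤ := fun n => (l + 1) * (m - 1 - n) + θ + lam n with hf
  have hgap : ∀ n k, n < k → f k + (l + 1) ≤ f n := by
    intro n k h
    have h1 : (lam k : ℤ) ≤ lam n := by exact_mod_cast hlam h.le
    have h2 : (n : ℤ) + 1 ≤ k := by exact_mod_cast h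
    simp only [hf]
    nlinarith
  have hanti : StrictAnti f := fun n k h => by
    have := hgap n k h
    omega
  set a : ℤ → ℕ := fun j => if ∃ n, f n = j then 1 else 0 with ha
  have hne : ∀ j, a j ≠ 0 ↔ ∃ n, f n = j := by
    intro j
    simp only [ha]
    split_ifs with h <;> simp [h]
  have h01 : ∀ j, a j = 0 ∨ a j = 1 := by
    intro j
    simp only [ha]
    split_ifs <;> simp
  refine ⟨a, ⟨h01, fun i => ?_, ?_, ?_⟩, hlam, hK, fun n => ?_⟩
  · by_cases h : ∀ r ∈ Finset.range (l + 1), a (i + r) = 0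
    · rw [Finset.sum_eq_zero h]
      exact zero_le_one
    · push Not at h
      obtain ⟨r, hr, hr'⟩ := h
      rw [Finset.sum_eq_single_of_mem r hr]
      · rcases h01 (i + r) with h | h <;> omega
      · intro k hk hkr
        by_contra h
        obtain ⟨n, hn⟩ := (hne _).1 hr'
        obtain ⟨n', hn'⟩ := (hne _).1 h
        rw [Finset.mem_range] at hr hk
        rcases lt_trichotomy n n' with hnn | hnn | hnn
        · have := hgap _ _ hnn
          omega
        · subst hnn
          omega
        · have := hgap _ _ hnn
          omega
  · filter_upwards [eventually_gt_atTop (f 0)] with j hj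
    by_contra h
    obtain ⟨n, rfl⟩ := (hne j).1 h
    exact (hanti.antitone (Nat.zero_le n)).not_gt hj
  · filter_upwards [eventually_lt_atBot (f K)] with j hj
    refine ⟨fun hmod => (h01 j).resolve_left ((hne j).2 ?_), fun hmod => ?_⟩
    · obtain ⟨q, hq⟩ := Int.modEq_iff_dvd.1 hmod.symm
      have hfK : f K = (l + 1) * (m - 1 - K) + θ := by simp [hf, hK K le_rfl]
      have hqK : q < m - 1 - K := by
        rw [hfK] at hj
        have : ((l : ℤ) + 1) * q < (l + 1) * (m - 1 - K) := by linarith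
        exact lt_of_mul_lt_mul_left this (by positivity)
      -- This index lies beyond `K`, where `lam` vanishes and `f` runs through the whole residue
      -- class.
      refine ⟨(m - 1 - q).toNat, ?_⟩
      simp only [hf]
      rw [hK _ (by omega), Int.toNat_of_nonneg (by omega)]
      push_cast
      linarith
    · by_contra h
      obtain ⟨n, rfl⟩ := (hne j).1 h
      have hn : K < n := hanti.lt_iff_gt.1 hj
      refine hmod (Int.modEq_iff_dvd.2 ⟨-(m - 1 - n), ?_⟩)
      simp only [hf]
      rw [hK n hn.le]
      push_cast
      ring
  · rw [tau_eq_of_enumeration hanti hne n]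
    simp only [hf]
    push_cast
    ring

/-! ### The monomial bases -/

theorem wellFounded_higher_sigma :
    WellFounded fun i j : (_ : ℤ) × (ℕ →₀ ℕ) => i.1 = j.1 ∧ Higher i.2 j.2 :=
  Subrelation.wf (r := InvImage Higher Sigma.snd) And.right
    (InvImage.wf _ wellFounded_higher)

theorem listVec_sub_mem_span {N : ℕ} (hc : (Real.sqrt N : ℂ) ≠ 0) {j m : ℤ} {L : List ℕ}
    (hL : L.Pairwise (· ≥ ·)) (hm : j + L.length = m) :
    listVec N j L - Finsupp.basis (fun _ : ℤ => completeBasis hc) ⟨m, listExp L⟩ ∈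
      Submodule.span ℂ (Finsupp.basis (fun _ : ℤ => completeBasis hc) ''
        {i | i.1 = m ∧ Higher i.2 (listExp L)}) := by
  subst hm
  obtain ⟨P, hP, hspan⟩ := listVec_triangular hc j L hL
  have h := Submodule.mem_map_of_mem
    (f := (Finsupp.lsingle (j + L.length) : Fock →ₗ[ℂ] Space N)) hspan
  rw [Submodule.map_span, Set.image_image, map_sub, Finsupp.lsingle_apply, Finsupp.lsingle_apply,
    ← hP] at h
  rw [Finsupp.coe_basis]
  beta_reduce
  rw [completeBasis_apply]
  refine Submodule.span_mono ?_ h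
  rintro _ ⟨t, ht, rfl⟩
  exact ⟨⟨_, t⟩, ⟨rfl, ht⟩, by simp [completeBasis_apply]⟩

/-- The common form of both parities, with `M = l + 1`; `t j` is the sequence of charge `j` and
empty partition. -/
theorem exists_monomial_basis (θ l : ℕ) (x : ℤ → Module.End ℂ (Space (l + 1)))
    (hx : ∀ n, x n = mode (l + 1) 1 (-n - θ)) (t : ℤ → ℕ → ℤ)
    (ht : ∀ j n, t j n = -((l + 1) * (j - 1 - n) + θ)) :
    ∃ b : Module.Basis (Fib θ l) ℂ (Space (l + 1)),
      ∀ a : Fib θ l, IsSemiInfiniteMonomial x t (tau a) (b a) := by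
  have hc : (Real.sqrt (l + 1 : ℕ) : ℂ) ≠ 0 := by
    rw [Complex.ofReal_ne_zero]
    exact (Real.sqrt_pos.2 (by positivity)).ne'
  choose m lam K hcode using fun a : Fib θ l => exists_isCode_of_mem_fib a.2
  let idx : Fib θ l → (_ : ℤ) × (ℕ →₀ ℕ) := fun a =>
    ⟨m a, listExp ((List.range (K a)).map (lam a))⟩
  have hidx : Function.Bijective idx := by
    constructor
    · intro a a' h
      have hm : m a = m a' := congrArg Sigma.fst h
      have hs : listExp ((List.range (K a)).map (lam a)) =
        listExp ((List.range (K a')).map (lam a')) := congrArg Sigma.snd h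
      -- The chosen bounds `K a` and `K a'` may differ; padding both lists with zeros to a common
      -- length makes them comparable.
      rw [← listExp_map_range (hcode a).eq_zero (le_max_left (K a) (K a')),
        ← listExp_map_range (hcode a').eq_zero (le_max_right (K a) (K a'))] at hs
      have hlist := eq_of_listExp_eq (pairwise_map_range (hcode a).antitone _)
        (pairwise_map_range (hcode a').antitone _) (by simp) hs
      have hlam : lam a = lam a' := by
        funext n
        by_cases hn : n < max (K a) (K a')
        · exact List.map_inj_left.1 hlist n (List.mem_range.2 hn)
        · rw [(hcode a).eq_zero n (by omega), (hcode a').eq_zero n (by omega)]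
      refine Subtype.ext (eq_of_tau_eq a.2 a'.2 (funext fun n => ?_))
      rw [(hcode a).eq, (hcode a').eq, hm, hlam]
    · rintro ⟨k, s⟩
      obtain ⟨L, hL, rfl⟩ := exists_listExp_eq s
      -- The default `0` of `getD` extends the finite list to a partition with infinitely many zero
      -- parts.
      have hanti : Antitone fun n => L.getD n 0 := by
        intro n n' hn
        rcases hn.eq_or_lt with rfl | hn
        · exact le_rfl
        by_cases h : n' < L.length
        · simp only [List.getD_eq_getElem L 0 h, List.getD_eq_getElem L 0 (hn.trans h)]
          exact List.pairwise_iff_getElem.1 hL _ _ _ _ hn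
        · simp only [List.getD_eq_default L 0 (not_lt.1 h)]
          exact Nat.zero_le _
      have hzero : ∀ n, L.length ≤ n → L.getD n 0 = 0 := fun n hn => List.getD_eq_default L 0 hn
      obtain ⟨a, ha, hcode'⟩ := exists_fib_isCode θ l k hanti hzero
      refine ⟨⟨a, ha⟩, ?_⟩
      obtain ⟨h1, h2⟩ := (hcode ⟨a, ha⟩).unique l.succ_pos hcode'
      have h3 : (List.range L.length).map (fun n => L.getD n 0) = L := by
        refine List.ext_getElem (by simp) fun n hn hn' => ?_
        rw [List.getElem_map, List.getElem_range, List.getD_eq_getElem L 0 hn']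
      have h4 := (hcode ⟨a, ha⟩).eq_zero
      have h5 : listExp ((List.range (K ⟨a, ha⟩)).map (lam ⟨a, ha⟩)) = listExp L := by
        rw [← listExp_map_range h4 (le_max_left _ L.length), h2,
          listExp_map_range hzero (le_max_right _ _), h3]
      simp only [idx]
      rw [h1, h5]
  let e := Equiv.ofBijective idx hidx
  let v : Fib θ l → Space (l + 1) := fun a =>
    listVec (l + 1) (m a - K a) ((List.range (K a)).map (lam a))
  obtain ⟨b, hb⟩ := exists_basis_of_triangular (Finsupp.basis fun _ : ℤ => completeBasis hc)
    (fun i => v (e.symm i)) _ wellFounded_higher_sigma fun i => by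
      obtain ⟨a, rfl⟩ := e.surjective i
      rw [e.symm_apply_apply]
      have hm : m a - K a + ((List.range (K a)).map (lam a)).length = m a := by simp
      exact listVec_sub_mem_span hc (pairwise_map_range (hcode a).antitone _) hm
  refine ⟨b.reindex e.symm, fun a => eventually_atTop.2 ⟨K a, fun k hk => ⟨m a - k, ?_, ?_⟩⟩⟩
  · intro n
    rw [(hcode a).eq, (hcode a).eq_zero _ (by omega), ht]
    push_cast
    ring
  · rw [Module.Basis.reindex_apply, Equiv.symm_symm, hb, e.symm_apply_apply,
      prod_range_ket_of_le hx (hcode a).eq (hcode a).eq_zero hk, prod_range_ket hx (hcode a).eq]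

end LatticeVOA

end

theorem theorem1 :
    (∀ N : ℕ, 1 ≤ N →
      ∃ b : Module.Basis (LatticeVOA.Fib N (2 * N - 1)) ℂ (LatticeVOA.Space (2 * N)),
        ∀ a : LatticeVOA.Fib N (2 * N - 1),
          LatticeVOA.IsSemiInfiniteMonomial (LatticeVOA.e N) (LatticeVOA.evenTail N)
            (LatticeVOA.tau a) (b a)) ∧
    (∀ N : ℕ,
      ∃ b : Module.Basis (LatticeVOA.Fib 0 (2 * N)) ℂ (LatticeVOA.Space (2 * N + 1)),
        ∀ a : LatticeVOA.Fib 0 (2 * N),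
          LatticeVOA.IsSemiInfiniteMonomial (LatticeVOA.theta N) (LatticeVOA.oddTail N)
            (LatticeVOA.tau a) (b a)) := by
  constructor
  · intro N hN
    -- `2 * N - 1 + 1` and `2 * N` are not syntactically equal, so the state space is generalized to
    -- `M` before `l + 1` is substituted for it.
    have key : ∀ l M : ℕ, M = 2 * N → l + 1 = M →
        ∀ x : ℤ → Module.End ℂ (LatticeVOA.Space M),
        (∀ n, x n = LatticeVOA.mode M 1 (-n - N)) →
        ∃ b : Module.Basis (LatticeVOA.Fib N l) ℂ (LatticeVOA.Space M),
          ∀ a : LatticeVOA.Fib N l, LatticeVOA.IsSemiInfiniteMonomial x (LatticeVOA.evenTail N)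
            (LatticeVOA.tau a) (b a) := by
      rintro l _ hM rfl x hx
      refine LatticeVOA.exists_monomial_basis N l x hx _ fun j n => ?_
      have : (l : ℤ) + 1 = 2 * N := by exact_mod_cast hM
      rw [this, LatticeVOA.evenTail]
      ring
    refine key (2 * N - 1) (2 * N) rfl (by omega) _ fun n => ?_
    rw [LatticeVOA.e, LatticeVOA.vertexOp, VertexOperator.of_coeff, HVertexOperator.coeff_of_coeff]
  · intro N
    refine LatticeVOA.exists_monomial_basis 0 (2 * N) _ (fun n => ?_) _ fun j n => ?_
    · rw [LatticeVOA.theta, LatticeVOA.vertexOp, VertexOperator.of_coeff,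
        HVertexOperator.coeff_of_coeff]
      simp
    · rw [LatticeVOA.oddTail]
      push_cast
      ring
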